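/- Let $\mathcal C$ be a dagger bicategory: every 2-morphism $\alpha:f\Rightarrow g$ has a converse $\alpha^\dagger:g\Rightarrow f$, the converse is involutive, contravariant for vertical and covariant for horizontal composition, and the structural 2-isomorphisms are unitary (a 2-morphism is unitary if its converse is its two-sided inverse). Let $\mathcal C$ carry a tensor product pseudofunctor $\boxtimes:\mathcal C\times\mathcal C\to\mathcal C$ compatible with $\dagger$ and a unit object $\mathbf 1$ with left and right unitors $\mathbf 1\boxtimes X\simeq X\simeq X\boxtimes\mathbf 1$ that are pseudonatural adjoint equivalences and are isomorphic at $X=\mathbf 1$, all structural 2-isomorphisms being unitary (for example, a symmetric monoidal dagger bicategory). Composition of 1-morphisms is written from left to right. Let $A$ and $B$ be objects with boundaries $l_A:\mathbf 1\to A$, $r_A:A\to\mathbf 1$ and $l_B:\mathbf 1\to B$, $r_B:B\to\mathbf 1$ satisfying the topological axioms: for $G\in\{A,B\}$ there are creation $\epsilon_G^\dagger:\mathrm{id}_{\mathbf 1}\Rightarrow l_G r_G$ and gluing $\mu_G:r_G l_G\Rightarrow\mathrm{id}_G$ which are unit and counit of an adjunction $l_G\dashv r_G$; their converses $\epsilon_G$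 (destruction) and $\mu_G^\dagger$ (separation) then exhibit $r_G\dashv l_G$. Let $\delta:l_A r_A\Rightarrow l_B r_B$ be a complementary structure: $\delta$ is unitary and so is its partial transpose $\delta':r_A l_B\Rightarrow r_A l_B$, the composite $$r_A l_B\xRightarrow{\ \mu_A^\dagger\ } r_A l_A r_A l_B\xRightarrow{\ \delta\ } r_A l_B r_B l_B\xRightarrow{\ \mu_B\ } r_A l_B .$$ Assume, as is implicit in drawing $\delta$ as a vertex that may be rotated in the plane, that the clockwise and the anticlockwise half turn of $\delta$ (its two transposes $l_B r_B\Rightarrow l_A r_A$, formed with the cups and caps above) coincide. Let $D=A\boxtimes B$, with boundaries $$l_D:\mathbf 1\xrightarrow{l_B}B\simeq\mathbf 1\boxtimes B\xrightarrow{l_A\boxtimes B}A\boxtimes B,\qquad r_D:A\boxtimes B\xrightarrow{A\boxtimes r_B}A\boxtimes\mathbf 1\simeq A\xrightarrow{r_A}\mathbf 1,$$ and with the adjunction $l_D\dashv r_D$ composed from those of $A$ and $B$, after crossing the two right boundaries by the interchange isomorphism of $\boxtimes$. Let $\chi$ be the interchange isomorphism from $r_B l_A$ to the composite $B\simeq\mathbf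 1\boxtimes B\xrightarrow{l_A\boxtimes B}A\boxtimes B\xrightarrow{A\boxtimes r_B}A\boxtimes\mathbf 1\simeq A$. Define $\lambda:(l_A r_A)(l_B r_B)\Rightarrow l_D r_D$ as the composite $$l_A(r_A l_B)r_B\xRightarrow{\ l_A\,\delta'\,r_B\ } (l_A r_A)(l_B r_B)\xRightarrow{\ \delta\,\cdot\,\delta^\dagger\ }(l_B r_B)(l_A r_A)=l_B(r_B l_A)r_A\xRightarrow{\ l_B\,\chi\,r_A\ } l_D r_D .$$ Then $\lambda$ is a communication structure: $\lambda$ is unitary, and so is its partial transpose $\lambda':(l_B r_B)l_D\Rightarrow(l_A r_A)l_D$, obtained by bending the strip $l_A r_A$ up on the left (with $\epsilon_A^\dagger$ and $\mu_A^\dagger$) and the boundary $r_D$ down on the right (with the counit $r_D l_D\Rightarrow\mathrm{id}_D$). -/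

import Mathlib

open CategoryTheory Bicategory

universe w v u

/-! ### Daggers on 2-morphisms -/

/-- A dagger bicategory: every 2-morphism `α : f ⟶ g` has a converse `dag α : g ⟶ f`. The converse
is an involution, reverses vertical composition, preserves horizontal composition, and the
coherence 2-isomorphisms of the bicategory are unitary. -/
class DaggerBicategory (C : Type u) [Bicategory.{w, v} C] where
  /-- The converse of a 2-morphism. -/
  dag {a b : C} {f g : a ⟶ b} (α : f ⟶ g) : g ⟶ f
  dag_dag {a b : C} {f g : a ⟶ b} (α : f ⟶ g) : dag (dag α) = α
  dag_id {a b : C} (f : a ⟶ b) : dag (𝟙 f) = 𝟙 f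
  dag_comp {a b : C} {f g h : a ⟶ b} (α : f ⟶ g) (β : g ⟶ h) :
    dag (α ≫ β) = dag β ≫ dag α
  dag_whiskerLeft {a b c : C} (f : a ⟶ b) {g h : b ⟶ c} (α : g ⟶ h) :
    dag (f ◁ α) = f ◁ dag α
  dag_whiskerRight {a b c : C} {f g : a ⟶ b} (α : f ⟶ g) (h : b ⟶ c) :
    dag (α ▷ h) = dag α ▷ h
  dag_associator {a b c d : C} (f : a ⟶ b) (g : b ⟶ c) (h : c ⟶ d) :
    dag (α_ f g h).hom = (α_ f g h).inv
  dag_leftUnitor {a b : C} (f : a ⟶ b) : dag (λ_ f).hom = (λ_ f).inv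
  dag_rightUnitor {a b : C} (f : a ⟶ b) : dag (ρ_ f).hom = (ρ_ f).inv

open DaggerBicategory

section Dagger

variable {C : Type u} [Bicategory.{w, v} C] [DaggerBicategory C]

/-- A 2-morphism is unitary if its converse is its two-sided inverse. -/
def IsUnitary {a b : C} {f g : a ⟶ b} (α : f ⟶ g) : Prop :=
  α ≫ dag α = 𝟙 f ∧ dag α ≫ α = 𝟙 g

theorem dag_associator_inv {a b c d : C} (f : a ⟶ b) (g : b ⟶ c) (h : c ⟶ d) :
    dag (α_ f g h).inv = (α_ f g h).hom := by
  rw [← dag_associator, dag_dag]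

theorem dag_leftUnitor_inv {a b : C} (f : a ⟶ b) : dag (λ_ f).inv = (λ_ f).hom := by
  rw [← dag_leftUnitor, dag_dag]

theorem dag_rightUnitor_inv {a b : C} (f : a ⟶ b) : dag (ρ_ f).inv = (ρ_ f).hom := by
  rw [← dag_rightUnitor, dag_dag]

/-- In a dagger bicategory adjunctions are ambidextrous: the converses of the counit and of the
unit of `f ⊣ g` are the unit and the counit of `g ⊣ f`. -/
def daggerAdjunction {a b : C} {f : a ⟶ b} {g : b ⟶ a} (adj : f ⊣ g) : g ⊣ f where
  unit := dag adj.counit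
  counit := dag adj.unit
  left_triangle := by
    have h := congrArg dag adj.right_triangle
    simpa [leftZigzag, rightZigzag, bicategoricalComp, dag_comp, dag_whiskerLeft,
      dag_whiskerRight, dag_associator, dag_associator_inv, dag_leftUnitor, dag_leftUnitor_inv,
      dag_rightUnitor, dag_rightUnitor_inv, dag_id] using h
  right_triangle := by
    have h := congrArg dag adj.left_triangle
    simpa [leftZigzag, rightZigzag, bicategoricalComp, dag_comp, dag_whiskerLeft,
      dag_whiskerRight, dag_associator, dag_associator_inv, dag_leftUnitor, dag_leftUnitor_inv,
      dag_rightUnitor, dag_rightUnitor_inv, dag_id] using h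

end Dagger

/-- Transport of an adjunction along an isomorphism of right adjoints. -/
def adjunctionOfRightIso {C : Type u} [Bicategory.{w, v} C] {a b : C} {f : a ⟶ b} {g g' : b ⟶ a}
    (adj : f ⊣ g) (e : g ≅ g') : f ⊣ g' where
  unit := adj.unit ≫ f ◁ e.hom
  counit := e.inv ▷ f ≫ adj.counit
  left_triangle := by
    rw [← adj.left_triangle]
    simp [leftZigzag, bicategoricalComp]
  right_triangle := by
    have h : g' ◁ (adj.unit ≫ f ◁ e.hom) ⊗≫ (e.inv ▷ f ≫ adj.counit) ▷ g' =
        e.inv ▷ 𝟙 a ≫ rightZigzag adj.unit adj.counit ≫ 𝟙 b ◁ e.hom := by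
      calc
        _ = 𝟙 _ ⊗≫ g' ◁ adj.unit ⊗≫ ((g' ≫ f) ◁ e.hom ≫ (e.inv ▷ f) ▷ g') ⊗≫
              adj.counit ▷ g' ⊗≫ 𝟙 _ := by bicategory
        _ = 𝟙 _ ⊗≫ (g' ◁ adj.unit ≫ e.inv ▷ (f ≫ g)) ⊗≫
              ((g ≫ f) ◁ e.hom ≫ adj.counit ▷ g') ⊗≫ 𝟙 _ := by
          rw [whisker_exchange (e.inv ▷ f) e.hom]; bicategory
        _ = _ := by
          rw [whisker_exchange e.inv adj.unit, whisker_exchange adj.counit e.hom]; bicategory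
    rw [rightZigzag, h, adj.right_triangle]
    simp

/-! ### The tensor product -/

/-- A dagger bicategory with a tensor product and a unit object: the part of the structure of a
(symmetric) monoidal dagger bicategory that does not involve the associator or the braiding.
All structural 2-isomorphisms are unitary. -/
class TensorBicategory (C : Type u) [Bicategory.{w, v} C] [DaggerBicategory C] where
  /-- The tensor product (layering of regions). -/
  tensor : (C × C) ⥤ᵖ C
  dag_map₂ {X Y : C × C} {f g : X ⟶ Y} (α : f ⟶ g) :
    dag (tensor.map₂ α) = tensor.map₂ (a := X) (b := Y) (f := g) (g := f) (dag α.1, dag α.2)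
  mapId_unitary (X : C × C) : IsUnitary (tensor.mapId X).hom
  mapComp_unitary {X Y Z : C × C} (f : X ⟶ Y) (g : Y ⟶ Z) : IsUnitary (tensor.mapComp f g).hom
  /-- The unit object (the unshaded region). -/
  unit : C
  /-- The left unitor `unit ⊠ X ⟶ X`, pseudonatural in `X`. -/
  leftUnitor : Pseudofunctor.StrongTrans
    ((Prod.sectR unit C).toPseudofunctor.comp tensor) (Pseudofunctor.id C)
  leftUnitor_naturality_unitary {X Y : C} (f : X ⟶ Y) : IsUnitary (leftUnitor.naturality f).hom
  /-- The inverse of the left unitor. -/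
  leftUnitorInv (X : C) : X ⟶ tensor.obj (unit, X)
  /-- The left unitor is an adjoint equivalence. -/
  leftUnitorAdj (X : C) : leftUnitorInv X ⊣ leftUnitor.app X
  leftUnitorAdj_unit_unitary (X : C) : IsUnitary (leftUnitorAdj X).unit
  leftUnitorAdj_counit_unitary (X : C) : IsUnitary (leftUnitorAdj X).counit
  /-- The right unitor `X ⊠ unit ⟶ X`, pseudonatural in `X`. -/
  rightUnitor : Pseudofunctor.StrongTrans
    ((Prod.sectL C unit).toPseudofunctor.comp tensor) (Pseudofunctor.id C)
  rightUnitor_naturality_unitary {X Y : C} (f : X ⟶ Y) : IsUnitary (rightUnitor.naturality f).hom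
  /-- The inverse of the right unitor. -/
  rightUnitorInv (X : C) : X ⟶ tensor.obj (X, unit)
  /-- The right unitor is an adjoint equivalence. -/
  rightUnitorAdj (X : C) : rightUnitorInv X ⊣ rightUnitor.app X
  rightUnitorAdj_unit_unitary (X : C) : IsUnitary (rightUnitorAdj X).unit
  rightUnitorAdj_counit_unitary (X : C) : IsUnitary (rightUnitorAdj X).counit
  /-- The two unitors agree on the unit object, up to a unitary 2-morphism. -/
  unitorIso : leftUnitor.app unit ≅ rightUnitor.app unit
  unitorIso_unitary : IsUnitary unitorIso.hom


open TensorBicategory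

section Tensor

variable {C : Type u} [Bicategory.{w, v} C] [DaggerBicategory C] [TensorBicategory C]

/-- Layering with the region `X` in the first layer, as a pseudofunctor. -/
abbrev leftSheet (X : C) : C ⥤ᵖ C := (Prod.sectR X C).toPseudofunctor.comp tensor

/-- Layering with the region `Y` in the second layer, as a pseudofunctor. -/
abbrev rightSheet (Y : C) : C ⥤ᵖ C := (Prod.sectL C Y).toPseudofunctor.comp tensor

/-- The overlap of two regions. -/
abbrev overlay (X Y : C) : C := tensor.obj (X, Y)

/-- The wire `g` in the second layer, with the region `X` in the first layer. -/
def secondLayer (X : C) {Y Y' : C} (g : Y ⟶ Y') : overlay X Y ⟶ overlay X Y' :=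
  (leftSheet X).map g

/-- The wire `f` in the first layer, with the region `Y` in the second layer. -/
def firstLayer {X X' : C} (f : X ⟶ X') (Y : C) : overlay X Y ⟶ overlay X' Y :=
  (rightSheet Y).map f

/-- An adjunction in the first layer. -/
def firstLayerAdj {X X' : C} {f : X ⟶ X'} {g : X' ⟶ X} (adj : f ⊣ g) (Y : C) :
    firstLayer f Y ⊣ firstLayer g Y :=
  (rightSheet Y).mapAdjunction adj

/-- Wires in different layers can be interchanged:
`(f ⊠ Y) ≫ (X' ⊠ g) ≅ f ⊠ g ≅ (X ⊠ g) ≫ (f ⊠ Y')`. -/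
def interchange {X X' Y Y' : C} (f : X ⟶ X') (g : Y ⟶ Y') :
    firstLayer f Y ≫ secondLayer X' g ≅ secondLayer X g ≫ firstLayer f Y' :=
  (tensor.mapComp (a := (X, Y)) (b := (X', Y)) (c := (X', Y')) (f, 𝟙 Y) (𝟙 X', g)).symm ≪≫
    tensor.map₂Iso (Iso.prod (ρ_ f ≪≫ (λ_ f).symm) (λ_ g ≪≫ (ρ_ g).symm)) ≪≫
    tensor.mapComp (a := (X, Y)) (b := (X, Y')) (c := (X', Y')) (𝟙 X, g) (f, 𝟙 Y')

/-- The left unitor at `X`. -/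
def leftUnit (X : C) : overlay unit X ⟶ X := leftUnitor.app X

/-- The right unitor at `X`. -/
def rightUnit (X : C) : overlay X unit ⟶ X := rightUnitor.app X

/-- The inverse of the left unitor at `X`. -/
def leftUnitInv (X : C) : X ⟶ overlay unit X := leftUnitorInv X

/-- The adjoint equivalence given by the left unitor at `X`. -/
def leftUnitAdj (X : C) : leftUnitInv X ⊣ leftUnit X := leftUnitorAdj X

/-- Naturality of the left unitor. -/
def leftUnitNat {X Y : C} (f : X ⟶ Y) :
    secondLayer unit f ≫ leftUnit Y ≅ leftUnit X ≫ f := leftUnitor.naturality f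

/-- Naturality of the right unitor. -/
def rightUnitNat {X Y : C} (f : X ⟶ Y) :
    firstLayer f unit ≫ rightUnit Y ≅ rightUnit X ≫ f := rightUnitor.naturality f

/-- The two unitors agree on the unit object. -/
def unitIso : leftUnit (unit : C) ≅ rightUnit (unit : C) := unitorIso

/-! ### Boundaries -/

/-- Left and right boundaries of a region `G`. The unit of the adjunction is creation
`𝟙 ⟶ left ≫ right` and its counit is gluing `right ≫ left ⟶ 𝟙`; their converses are destruction
and separation. The two triangle identities, with their converses (`daggerAdjunction`), are the
four topological (ambidextrous adjunction) axioms. One-morphisms are composed from left to right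
across the diagram. -/
structure Boundary (G : C) where
  /-- The left boundary: unshaded to the left, `G` to the right. -/
  left : (unit : C) ⟶ G
  /-- The right boundary: `G` to the left, unshaded to the right. -/
  right : G ⟶ (unit : C)
  /-- Creation and gluing. -/
  adj : left ⊣ right

namespace Boundary

variable {G : C} (b : Boundary G)

/-- The whole system: a strip of `G` between its two boundaries. -/
abbrev strip : (unit : C) ⟶ unit := b.left ≫ b.right

/-- Creation. -/
abbrev create : 𝟙 (unit : C) ⟶ b.left ≫ b.right := b.adj.unit

/-- Gluing. -/
abbrev glue : b.right ≫ b.left ⟶ 𝟙 G := b.adj.counit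

/-- Destruction. -/
abbrev destroy : b.left ≫ b.right ⟶ 𝟙 (unit : C) := dag b.adj.unit

/-- Separation. -/
abbrev separate : 𝟙 G ⟶ b.right ≫ b.left := dag b.adj.counit

/-- The cup on a strip: create a strip, then separate it into two. -/
def cup : 𝟙 (unit : C) ⟶ b.strip ≫ b.strip :=
  b.create ⊗≫ b.left ◁ b.separate ▷ b.right ⊗≫ 𝟙 _

/-- The cap on a strip: glue two strips, then destroy the result. -/
def cap : b.strip ≫ b.strip ⟶ 𝟙 (unit : C) :=
  𝟙 _ ⊗≫ b.left ◁ b.glue ▷ b.right ⊗≫ b.destroy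

end Boundary

/-! ### Complementary structures -/

section Complementary

variable {A B : C} (a : Boundary A) (b : Boundary B)

/-- The partial transpose of `δ` (a clockwise quarter turn): the left boundary of `A` is bent up
on the left, the right boundary of `B` is bent down on the right. -/
def partialTranspose (δ : a.strip ⟶ b.strip) : a.right ≫ b.left ⟶ a.right ≫ b.left :=
  𝟙 _ ⊗≫ a.separate ▷ (a.right ≫ b.left) ⊗≫ a.right ◁ δ ▷ b.left ⊗≫
    (a.right ≫ b.left) ◁ b.glue ⊗≫ 𝟙 _

/-- A complementary structure. -/
def IsComplementaryStructure (δ : a.strip ⟶ b.strip) : Prop :=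
  IsUnitary δ ∧ IsUnitary (partialTranspose a b δ)

/-- Clockwise half turn of `δ`. -/
def halfTurnClockwise (δ : a.strip ⟶ b.strip) : b.strip ⟶ a.strip :=
  𝟙 _ ⊗≫ a.cup ▷ b.strip ⊗≫ a.strip ◁ δ ▷ b.strip ⊗≫ a.strip ◁ b.cap ⊗≫ 𝟙 _

/-- Anticlockwise half turn of `δ`. -/
def halfTurnAnticlockwise (δ : a.strip ⟶ b.strip) : b.strip ⟶ a.strip :=
  𝟙 _ ⊗≫ b.strip ◁ a.cup ⊗≫ b.strip ◁ δ ▷ a.strip ⊗≫ b.cap ▷ a.strip ⊗≫ 𝟙 _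

/-- The vertex `δ` may be rotated in the plane: only its angle matters, that is, the two half
turns of `δ` agree (equivalently, a full turn does not change `δ`). -/
def IsRotatable (δ : a.strip ⟶ b.strip) : Prop :=
  halfTurnClockwise a b δ = halfTurnAnticlockwise a b δ

end Complementary

/-! ### Communication structures -/

section Communication

variable {A B D : C} (a : Boundary A) (b : Boundary B) (d : Boundary D)

/-- The partial transpose of `l` (a clockwise quarter turn): the strip of `A` is bent up on the
left, the right boundary of `D` is bent down on the right. -/
def commPartialTranspose (l : a.strip ≫ b.strip ⟶ d.strip) :
    b.strip ≫ d.left ⟶ a.strip ≫ d.left :=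
  𝟙 _ ⊗≫ a.cup ▷ (b.strip ≫ d.left) ⊗≫ a.strip ◁ l ▷ d.left ⊗≫
    (a.strip ≫ d.left) ◁ d.glue ⊗≫ 𝟙 _

/-- A communication structure. -/
def IsCommunicationStructure (l : a.strip ≫ b.strip ⟶ d.strip) : Prop :=
  IsUnitary l ∧ IsUnitary (commPartialTranspose a b d l)

end Communication

/-! ### Overlapping regions -/

section Overlap

variable {A B : C} (a : Boundary A) (b : Boundary B)

/-- The left boundary of the overlap `A ⊠ B`: first the left boundary of `B`, then that of `A` in
its own layer. -/
def overlapLeft : (unit : C) ⟶ overlay A B :=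
  b.left ≫ leftUnitInv B ≫ firstLayer a.left B

/-- The right boundary of the overlap `A ⊠ B`: first the right boundary of `B` in its own layer,
then that of `A`. -/
def overlapRight : overlay A B ⟶ (unit : C) :=
  secondLayer A b.right ≫ rightUnit A ≫ a.right

/-- The two right boundaries cross. -/
def crossRight :
    firstLayer a.right B ≫ leftUnit B ≫ b.right ≅ overlapRight a b :=
  whiskerLeftIso (firstLayer a.right B) (leftUnitNat b.right).symm ≪≫
    (α_ _ _ _).symm ≪≫
    whiskerRightIso (interchange a.right b.right) (leftUnit unit) ≪≫
    whiskerLeftIso (secondLayer A b.right ≫ firstLayer a.right unit) unitIso ≪≫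
    α_ _ _ _ ≪≫
    whiskerLeftIso (secondLayer A b.right) (rightUnitNat a.right)

/-- The right boundary of `B` crosses the left boundary of `A`, so that the regions overlap. -/
def crossMiddle : b.right ≫ a.left ⟶
    (leftUnitInv B ≫ firstLayer a.left B) ≫ secondLayer A b.right ≫ rightUnit A :=
  𝟙 _ ⊗≫ (leftUnitAdj B).unit ▷ (b.right ≫ a.left) ⊗≫
    leftUnitInv B ◁ ((leftUnitNat b.right).inv ▷ a.left) ⊗≫
    (leftUnitInv B ≫ secondLayer unit b.right) ◁ (unitIso.hom ▷ a.left) ⊗≫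
    (leftUnitInv B ≫ secondLayer unit b.right) ◁ (rightUnitNat a.left).inv ⊗≫
    leftUnitInv B ◁ (interchange a.left b.right).inv ▷ rightUnit A ⊗≫ 𝟙 _

/-- The boundaries of the overlap `A ⊠ B`. The adjunction is composed from those of the two layers,
with the two right boundaries crossed. -/
def Boundary.overlap : Boundary (overlay A B) where
  left := overlapLeft a b
  right := overlapRight a b
  adj := adjunctionOfRightIso
    (b.adj.comp ((leftUnitAdj B).comp (firstLayerAdj a.adj B)))
    ((α_ _ _ _) ≪≫ crossRight a b)

/-- The 2-morphism built from three copies of `δ`: the partial transpose of `δ` on the two inner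
boundaries, then `δ` on the left strip and the converse of `δ` on the right strip, then the inner
boundaries cross. -/
def commOfComp (δ : a.strip ⟶ b.strip) : a.strip ≫ b.strip ⟶ (a.overlap b).strip :=
  𝟙 _ ⊗≫ a.left ◁ partialTranspose a b δ ▷ b.right ⊗≫ δ ▷ b.strip ≫ b.strip ◁ dag δ ⊗≫
    b.left ◁ crossMiddle a b ▷ a.right ⊗≫
    𝟙 ((b.left ≫ leftUnitInv B ≫ firstLayer a.left B) ≫
      (secondLayer A b.right ≫ rightUnit A ≫ a.right))

end Overlap

end Tensor

/-!
Bending the strip of `A` and the right boundary of `A ⊠ B` turns `commOfComp a b δ` into a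
composite of rotated copies of `δ` and crossings of the two left boundaries (`rotatedComp`), so it
is enough that each of these factors is unitary. For the copies of `δ` this is where rotatability
enters: the clockwise half turn of `δ` is its conjugate, and when the two half turns agree it
commutes with the converse, so that conjugating `δ ≫ dag δ = 𝟙` shows that the half turn is
unitary; the quarter turn of `dag δ` is in the same way a conjugate of the converse of the quarter
turn of `δ`. For the crossings, the crossing of the left boundaries is by construction the conjugate
of the crossing of the right boundaries; the latter is a composite of interchange and unitor
2-isomorphisms, whose conjugates are again structural because taking mates commutes with
pseudofunctors and with pseudonatural transformations. The middle crossing in `commOfComp` is the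
mate half-way between the two, so the bent right crossing and the middle crossing combine into
crossings of left boundaries.
-/

/-! ### Unitary 2-morphisms -/

section Unitary

variable {C : Type u} [Bicategory.{w, v} C] [DaggerBicategory C]

namespace IsUnitary

variable {a b c : C}

theorem id (f : a ⟶ b) : IsUnitary (𝟙 f) := by
  simp [IsUnitary, dag_id]

theorem comp {f g h : a ⟶ b} {α : f ⟶ g} {β : g ⟶ h} (hα : IsUnitary α) (hβ : IsUnitary β) :
    IsUnitary (α ≫ β) := by
  constructor
  · rw [dag_comp, Category.assoc, ← Category.assoc β, hβ.1, Category.id_comp, hα.1]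
  · rw [dag_comp, Category.assoc, ← Category.assoc _ α, hα.2, Category.id_comp, hβ.2]

theorem whiskerLeft (f : a ⟶ b) {g h : b ⟶ c} {α : g ⟶ h} (hα : IsUnitary α) :
    IsUnitary (f ◁ α) := by
  simp [IsUnitary, dag_whiskerLeft, ← Bicategory.whiskerLeft_comp, hα.1, hα.2]

theorem whiskerRight {f g : a ⟶ b} {α : f ⟶ g} (hα : IsUnitary α) (h : b ⟶ c) :
    IsUnitary (α ▷ h) := by
  simp [IsUnitary, dag_whiskerRight, ← Bicategory.comp_whiskerRight, hα.1, hα.2]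

theorem dag {f g : a ⟶ b} {α : f ⟶ g} (hα : IsUnitary α) : IsUnitary (dag α) := by
  simpa [IsUnitary, dag_dag] using And.symm hα

theorem dag_eq_inv {f g : a ⟶ b} {e : f ≅ g} (he : IsUnitary e.hom) :
    DaggerBicategory.dag e.hom = e.inv := by
  rw [← cancel_epi e.hom, he.1, e.hom_inv_id]

theorem inv {f g : a ⟶ b} {e : f ≅ g} (he : IsUnitary e.hom) : IsUnitary e.inv :=
  he.dag_eq_inv ▸ he.dag

theorem associator {d : C} (f : a ⟶ b) (g : b ⟶ c) (h : c ⟶ d) : IsUnitary (α_ f g h).hom := by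
  simp [IsUnitary, dag_associator]

theorem leftUnitor (f : a ⟶ b) : IsUnitary (λ_ f).hom := by
  simp [IsUnitary, dag_leftUnitor]

theorem rightUnitor (f : a ⟶ b) : IsUnitary (ρ_ f).hom := by
  simp [IsUnitary, dag_rightUnitor]

end IsUnitary

/-- The 2-morphism inserted by `⊗≫` is unitary. -/
class UnitaryCoherence {a b : C} (f g : a ⟶ b) [BicategoricalCoherence f g] : Prop where
  isUnitary : IsUnitary (BicategoricalCoherence.iso : f ≅ g).hom

namespace UnitaryCoherence

variable {a b c d : C}

instance refl (f : a ⟶ b) : UnitaryCoherence f f := ⟨.id f⟩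

instance whiskerLeft (f : a ⟶ b) (g h : b ⟶ c) [BicategoricalCoherence g h]
    [UnitaryCoherence g h] : UnitaryCoherence (f ≫ g) (f ≫ h) :=
  ⟨.whiskerLeft f isUnitary⟩

instance whiskerRight (f g : a ⟶ b) (h : b ⟶ c) [BicategoricalCoherence f g]
    [UnitaryCoherence f g] : UnitaryCoherence (f ≫ h) (g ≫ h) :=
  ⟨.whiskerRight isUnitary h⟩

instance left' (f g : a ⟶ b) [BicategoricalCoherence f g] [UnitaryCoherence f g] :
    UnitaryCoherence f (𝟙 a ≫ g) :=
  ⟨.comp isUnitary (IsUnitary.leftUnitor g).inv⟩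

instance right (f g : a ⟶ b) [BicategoricalCoherence f g] [UnitaryCoherence f g] :
    UnitaryCoherence (f ≫ 𝟙 b) g :=
  ⟨.comp (.rightUnitor f) isUnitary⟩

instance assoc (f : a ⟶ b) (g : b ⟶ c) (h : c ⟶ d) (i : a ⟶ d)
    [BicategoricalCoherence (f ≫ g ≫ h) i] [UnitaryCoherence (f ≫ g ≫ h) i] :
    UnitaryCoherence ((f ≫ g) ≫ h) i :=
  ⟨.comp (.associator f g h) isUnitary⟩

instance assoc' (f : a ⟶ b) (g : b ⟶ c) (h : c ⟶ d) (i : a ⟶ d)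
    [BicategoricalCoherence i (f ≫ g ≫ h)] [UnitaryCoherence i (f ≫ g ≫ h)] :
    UnitaryCoherence i ((f ≫ g) ≫ h) :=
  ⟨.comp isUnitary (IsUnitary.associator f g h).inv⟩

end UnitaryCoherence

theorem IsUnitary.bicategoricalComp {a b : C} {f g h i : a ⟶ b} [BicategoricalCoherence g h]
    [UnitaryCoherence g h] {α : f ⟶ g} {β : h ⟶ i} (hα : IsUnitary α) (hβ : IsUnitary β) :
    IsUnitary (α ⊗≫ β) :=
  hα.comp (.comp UnitaryCoherence.isUnitary hβ)

end Unitary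

/-! ### Mates and conjugates -/

section Mates

variable {C : Type u} [Bicategory.{w, v} C]

theorem homEquiv₂_symm_mateEquiv {c d e f : C} {g : c ⟶ e} {h : d ⟶ f} {l₁ : c ⟶ d} {r₁ : d ⟶ c}
    {l₂ : e ⟶ f} {r₂ : f ⟶ e} (adj₁ : l₁ ⊣ r₁) (adj₂ : l₂ ⊣ r₂) (α : g ≫ l₂ ⟶ l₁ ≫ h) :
    adj₂.homEquiv₂.symm (Bicategory.mateEquiv adj₁ adj₂ α) =
      (α_ _ _ _).hom ≫ adj₁.homEquiv₁ α := by
  rw [Equiv.symm_apply_eq, Bicategory.mateEquiv_apply', Adjunction.homEquiv₂_apply,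
    Adjunction.homEquiv₁_apply]
  bicategory

theorem mateEquiv_eq_iff_counit {c d e f : C} {g : c ⟶ e} {h : d ⟶ f} {l₁ : c ⟶ d} {r₁ : d ⟶ c}
    {l₂ : e ⟶ f} {r₂ : f ⟶ e} {adj₁ : l₁ ⊣ r₁} {adj₂ : l₂ ⊣ r₂} {α : g ≫ l₂ ⟶ l₁ ≫ h}
    {β : r₁ ≫ g ⟶ h ≫ r₂} :
    Bicategory.mateEquiv adj₁ adj₂ α = β ↔
      β ▷ l₂ ≫ (α_ h r₂ l₂).hom ≫ h ◁ adj₂.counit ≫ (ρ_ h).hom =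
        (α_ r₁ g l₂).hom ≫ r₁ ◁ α ≫ (α_ r₁ l₁ h).inv ≫ adj₁.counit ▷ h ≫ (λ_ h).hom := by
  rw [← adj₂.homEquiv₂.symm.apply_eq_iff_eq, homEquiv₂_symm_mateEquiv, eq_comm,
    Adjunction.homEquiv₂_symm_apply, Adjunction.homEquiv₁_apply]

theorem conjugateEquiv_counit {c d : C} {l₁ l₂ : c ⟶ d} {r₁ r₂ : d ⟶ c} (adj₁ : l₁ ⊣ r₁)
    (adj₂ : l₂ ⊣ r₂) (α : l₂ ⟶ l₁) :
    Bicategory.conjugateEquiv adj₁ adj₂ α ▷ l₂ ≫ adj₂.counit = r₁ ◁ α ≫ adj₁.counit := by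
  have h := mateEquiv_eq_iff_counit.mp
    (rfl : Bicategory.mateEquiv adj₁ adj₂ ((λ_ l₂).hom ≫ α ≫ (ρ_ l₁).inv) = _)
  simpa [Bicategory.conjugateEquiv_apply] using (ρ_ r₁).inv ▷ l₂ ≫= h

theorem adjunctionOfRightIso_counit {X Y : C} {l₁ l₂ : X ⟶ Y} {r₁ r₂ r : Y ⟶ X}
    (adj₁ : l₁ ⊣ r₁) (adj₂ : l₂ ⊣ r₂) (κ₁ : r₁ ≅ r) (κ₂ : r₂ ≅ r) :
    (adjunctionOfRightIso adj₁ κ₁).counit =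
      r ◁ ((Bicategory.conjugateIsoEquiv adj₁ adj₂).symm (κ₁ ≪≫ κ₂.symm)).inv ≫
        κ₂.inv ▷ l₂ ≫ adj₂.counit := by
  have h := conjugateEquiv_counit adj₂ adj₁
    ((Bicategory.conjugateIsoEquiv adj₁ adj₂).symm (κ₁ ≪≫ κ₂.symm)).inv
  have hκ : Bicategory.conjugateEquiv adj₂ adj₁
      ((Bicategory.conjugateIsoEquiv adj₁ adj₂).symm (κ₁ ≪≫ κ₂.symm)).inv =
      κ₂.hom ≫ κ₁.inv :=
    congrArg Iso.inv ((Bicategory.conjugateIsoEquiv _ _).apply_symm_apply (κ₁ ≪≫ κ₂.symm))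
  rw [whisker_exchange_assoc, ← h, hκ, ← comp_whiskerRight_assoc, Iso.inv_hom_id_assoc]
  rfl

theorem mateEquiv_id_rightUnitor_hom_leftUnitor_inv {a b : C} (f : a ⟶ b) :
    Bicategory.mateEquiv (Bicategory.Adjunction.id a) (Bicategory.Adjunction.id b)
      ((ρ_ f).hom ≫ (λ_ f).inv) = (λ_ f).hom ≫ (ρ_ f).inv := by
  rw [mateEquiv_eq_iff_counit]
  simp [Bicategory.Adjunction.id]

theorem mateEquiv_whiskerRight_counit {A B D U V : C} {lA : U ⟶ A} {rA : A ⟶ U} {lB : U ⟶ B}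
    {rB : B ⟶ U} {F : B ⟶ D} {s : D ⟶ V} {t : V ⟶ A} {E : A ⟶ D}
    (adjA : lA ⊣ rA) (adjB : lB ⊣ rB) (adjE : E ⊣ s ≫ t) (e : lA ≫ E ≅ lB ≫ F) :
    Bicategory.mateEquiv adjB adjE e.hom ▷ (rA ≫ lB ≫ F) ⊗≫
        F ◁ ((s ≫ t ≫ rA) ◁ e.inv ≫ (α_ s t rA).inv ▷ _ ≫ (adjA.comp adjE).counit) ⊗≫ 𝟙 F =
      𝟙 _ ⊗≫ (rB ≫ lA ≫ rA) ◁ e.inv ⊗≫ (rB ≫ lA) ◁ adjA.counit ▷ E ⊗≫ rB ◁ e.hom ⊗≫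
        adjB.counit ▷ F ⊗≫ 𝟙 _ := by
  have h := mateEquiv_eq_iff_counit.1 (rfl : Bicategory.mateEquiv adjB adjE e.hom = _)
  calc
    _ = 𝟙 _ ⊗≫ (Bicategory.mateEquiv adjB adjE e.hom ▷ (rA ≫ lB ≫ F) ≫
          (F ≫ s ≫ t) ◁ (rA ◁ e.inv ⊗≫ adjA.counit ▷ E)) ⊗≫ F ◁ adjE.counit ⊗≫ 𝟙 F := by
      simp only [Bicategory.Adjunction.comp, Bicategory.Adjunction.compCounit]
      bicategory
    _ = 𝟙 _ ⊗≫ (rB ≫ lA) ◁ (rA ◁ e.inv ⊗≫ adjA.counit ▷ E) ⊗≫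
          (Bicategory.mateEquiv adjB adjE e.hom ▷ E ≫ (α_ _ _ _).hom ≫ F ◁ adjE.counit ≫
            (ρ_ F).hom) := by
      rw [← whisker_exchange]
      bicategory
    _ = _ := by
      rw [h]
      bicategory

end Mates

section Conjugate

variable {C : Type u} [Bicategory.{w, v} C] [DaggerBicategory C]

theorem IsUnitary.mateEquiv_symm {c d e f : C} {g : c ⟶ e} {h : d ⟶ f} {l₁ : c ⟶ d} {r₁ : d ⟶ c}
    {l₂ : e ⟶ f} {r₂ : f ⟶ e} {adj₁ : l₁ ⊣ r₁} {adj₂ : l₂ ⊣ r₂} {β : r₁ ≫ g ⟶ h ≫ r₂}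
    (hβ : IsUnitary β) (h₁ : IsUnitary adj₁.unit) (h₂ : IsUnitary adj₂.counit) :
    IsUnitary ((Bicategory.mateEquiv adj₁ adj₂).symm β) := by
  rw [Bicategory.mateEquiv_symm_apply']
  exact (IsUnitary.id _).bicategoricalComp <| .bicategoricalComp
    (.whiskerRight (.whiskerRight h₁ g) l₂) <| .bicategoricalComp
    (.whiskerLeft l₁ (.whiskerRight hβ l₂)) <| .bicategoricalComp
    (.whiskerLeft l₁ (.whiskerLeft h h₂)) (.id _)

/-- A 2-morphism of right adjoints whose conjugate, the corresponding 2-morphism of left adjoints,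
is unitary. -/
def HasUnitaryConjugate {c d : C} {l₁ l₂ : c ⟶ d} {r₁ r₂ : d ⟶ c} (adj₁ : l₁ ⊣ r₁)
    (adj₂ : l₂ ⊣ r₂) (β : r₁ ⟶ r₂) : Prop :=
  IsUnitary ((Bicategory.conjugateEquiv adj₁ adj₂).symm β)

namespace HasUnitaryConjugate

variable {c d : C} {l₁ l₂ l₃ : c ⟶ d} {r₁ r₂ r₃ : d ⟶ c} {adj₁ : l₁ ⊣ r₁} {adj₂ : l₂ ⊣ r₂}
  {adj₃ : l₃ ⊣ r₃}

theorem comp {β : r₁ ⟶ r₂} {γ : r₂ ⟶ r₃} (hβ : HasUnitaryConjugate adj₁ adj₂ β)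
    (hγ : HasUnitaryConjugate adj₂ adj₃ γ) : HasUnitaryConjugate adj₁ adj₃ (β ≫ γ) := by
  rw [HasUnitaryConjugate, ← Bicategory.conjugateEquiv_symm_comp adj₁ adj₂ adj₃]
  exact IsUnitary.comp hγ hβ

theorem inv {e : r₁ ≅ r₂} (he : HasUnitaryConjugate adj₁ adj₂ e.hom) :
    HasUnitaryConjugate adj₂ adj₁ e.inv :=
  IsUnitary.inv (e := (Bicategory.conjugateIsoEquiv adj₁ adj₂).symm e) he

theorem whiskerLeft {β : r₁ ⟶ r₂} (hβ : HasUnitaryConjugate adj₁ adj₂ β) {e : C} {l : d ⟶ e}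
    {r : e ⟶ d} (adj : l ⊣ r) :
    HasUnitaryConjugate (adj₁.comp adj) (adj₂.comp adj) (r ◁ β) := by
  rw [HasUnitaryConjugate, ← (Bicategory.conjugateEquiv adj₁ adj₂).apply_symm_apply β,
    ← Bicategory.conjugateEquiv_whiskerRight, Equiv.symm_apply_apply]
  exact IsUnitary.whiskerRight hβ l

theorem whiskerRight {β : r₁ ⟶ r₂} (hβ : HasUnitaryConjugate adj₁ adj₂ β) {e : C} {l : e ⟶ c}
    {r : c ⟶ e} (adj : l ⊣ r) :
    HasUnitaryConjugate (adj.comp adj₁) (adj.comp adj₂) (β ▷ r) := by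
  rw [HasUnitaryConjugate, ← (Bicategory.conjugateEquiv adj₁ adj₂).apply_symm_apply β,
    ← Bicategory.conjugateEquiv_whiskerLeft, Equiv.symm_apply_apply]
  exact IsUnitary.whiskerLeft l hβ

theorem associator {a₀ a₁ a₂ a₃ : C} {l₁ : a₀ ⟶ a₁} {r₁ : a₁ ⟶ a₀} {l₂ : a₁ ⟶ a₂} {r₂ : a₂ ⟶ a₁}
    {l₃ : a₂ ⟶ a₃} {r₃ : a₃ ⟶ a₂} (adj₁ : l₁ ⊣ r₁) (adj₂ : l₂ ⊣ r₂) (adj₃ : l₃ ⊣ r₃) :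
    HasUnitaryConjugate (adj₁.comp (adj₂.comp adj₃)) ((adj₁.comp adj₂).comp adj₃)
      (α_ r₃ r₂ r₁).hom := by
  rw [HasUnitaryConjugate, ← Bicategory.conjugateEquiv_associator_hom, Equiv.symm_apply_apply]
  exact .associator l₁ l₂ l₃

theorem of_isUnitary_unit_counit {β : r₁ ⟶ r₂} (hβ : IsUnitary β) (h₁ : IsUnitary adj₁.unit)
    (h₂ : IsUnitary adj₂.counit) : HasUnitaryConjugate adj₁ adj₂ β := by
  rw [HasUnitaryConjugate, Bicategory.conjugateEquiv_symm_apply']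
  exact (IsUnitary.leftUnitor _).inv.comp <| .comp (.whiskerRight h₁ _) <|
    .comp (.associator _ _ _) <| .comp (.whiskerLeft _ (.whiskerRight hβ _)) <|
    .comp (.whiskerLeft _ h₂) (.rightUnitor _)

theorem mateEquiv {a b c d : C} {l₁ : a ⟶ b} {r₁ : b ⟶ a} {l₂ : c ⟶ d} {r₂ : d ⟶ c} {f₁ : a ⟶ c}
    {u₁ : c ⟶ a} {f₂ : b ⟶ d} {u₂ : d ⟶ b} {adj₁ : l₁ ⊣ r₁} {adj₂ : l₂ ⊣ r₂} (adj₃ : f₁ ⊣ u₁)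
    (adj₄ : f₂ ⊣ u₂) {α : f₁ ≫ l₂ ⟶ l₁ ≫ f₂} (hα : IsUnitary α) :
    HasUnitaryConjugate (adj₁.comp adj₄) (adj₃.comp adj₂)
      (Bicategory.mateEquiv adj₄ adj₃ (Bicategory.mateEquiv adj₁ adj₂ α)) := by
  rwa [HasUnitaryConjugate, Bicategory.iterated_mateEquiv_conjugateEquiv, Equiv.symm_apply_apply]

end HasUnitaryConjugate

end Conjugate

/-! ### Pseudofunctors and products -/

universe w₁ v₁ u₁ w₂ v₂ u₂

section Pseudofunctors

variable {B : Type u₁} [Bicategory.{w₁, v₁} B] {C : Type u₂} [Bicategory.{w₂, v₂} C]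

theorem map_mateEquiv {D : Type u₁} [Bicategory.{w₁, v₁} D] (H : C ⥤ᵖ D) {c d e f : C}
    {g : c ⟶ e} {h : d ⟶ f} {l₁ : c ⟶ d} {r₁ : d ⟶ c} {l₂ : e ⟶ f} {r₂ : f ⟶ e} (adj₁ : l₁ ⊣ r₁)
    (adj₂ : l₂ ⊣ r₂) (α : g ≫ l₂ ⟶ l₁ ≫ h) :
    Bicategory.mateEquiv (H.mapAdjunction adj₁) (H.mapAdjunction adj₂)
      ((H.mapComp g l₂).inv ≫ H.map₂ α ≫ (H.mapComp l₁ h).hom) =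
      (H.mapComp r₁ g).inv ≫ H.map₂ (Bicategory.mateEquiv adj₁ adj₂ α) ≫ (H.mapComp h r₂).hom := by
  have hassoc : H.map₂ (α_ r₁ l₁ h).inv = (H.mapComp r₁ (l₁ ≫ h)).hom ≫
      H.map r₁ ◁ (H.mapComp l₁ h).hom ≫ (α_ _ _ _).inv ≫ (H.mapComp r₁ l₁).inv ▷ H.map h ≫
        (H.mapComp (r₁ ≫ l₁) h).inv := by
    rw [H.mapComp_assoc_right_hom_assoc]
    simp
  have w := congrArg H.map₂
    (mateEquiv_eq_iff_counit.mp (rfl : Bicategory.mateEquiv adj₁ adj₂ α = _))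
  simp only [H.map₂_comp, H.map₂_associator, H.map₂_whisker_left, H.map₂_whisker_right,
    H.map₂_left_unitor, H.map₂_right_unitor, hassoc, Category.assoc, Iso.inv_hom_id_assoc,
    cancel_epi] at w
  rw [mateEquiv_eq_iff_counit]
  simpa using (H.mapComp r₁ g).inv ▷ H.map l₂ ≫= w

theorem mateEquiv_naturality_inv {F G : B ⥤ᵖ C} (η : Pseudofunctor.StrongTrans F G) {a b : B}
    {f : a ⟶ b} {g : b ⟶ a} (adj : f ⊣ g) :
    Bicategory.mateEquiv (F.mapAdjunction adj) (G.mapAdjunction adj) (η.naturality f).inv =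
      (η.naturality g).hom := by
  have hcomp : (η.naturality g).hom ▷ G.map f ≫ (α_ _ _ _).hom ≫
      η.app b ◁ (G.mapComp g f).inv = (α_ _ _ _).hom ≫ F.map g ◁ (η.naturality f).inv ≫
        (α_ _ _ _).inv ≫ (F.mapComp g f).inv ▷ η.app b ≫ (η.naturality (g ≫ f)).hom := by
    rw [← cancel_mono (η.app b ◁ (G.mapComp g f).hom)]
    simp
  have hcounit := η.naturality_naturality_assoc adj.counit (η.app b ◁ (G.mapId b).hom)
  rw [η.naturality_id] at hcounit
  rw [mateEquiv_eq_iff_counit, Pseudofunctor.mapAdjunction_counit,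
    Pseudofunctor.mapAdjunction_counit]
  simp only [Bicategory.whiskerLeft_comp, Category.assoc, reassoc_of% hcomp, ← reassoc_of% hcounit]
  simp

theorem mapAdjunction_comp {D : Type u} [Bicategory.{w, v} D] (F : B ⥤ᵖ C) (G : C ⥤ᵖ D)
    {a b : B} {f : a ⟶ b} {g : b ⟶ a} (adj : f ⊣ g) :
    (F.comp G).mapAdjunction adj = G.mapAdjunction (F.mapAdjunction adj) := by
  ext
  · simp only [Pseudofunctor.mapAdjunction_unit, PrelaxFunctor.map₂_comp, Category.assoc]
    exact Category.assoc _ _ _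
  · simp only [Pseudofunctor.mapAdjunction_counit, PrelaxFunctor.map₂_comp, Category.assoc]
    exact Category.assoc _ _ _

theorem id_mapAdjunction {a b : B} {f : a ⟶ b} {g : b ⟶ a} (adj : f ⊣ g) :
    (Pseudofunctor.id B).mapAdjunction adj = adj := by
  ext
  · exact (Category.id_comp _).trans (Category.comp_id _)
  · exact (Category.id_comp _).trans (Category.comp_id _)

/-- The adjunction `(f, f') ⊣ (g, g')` in a product of bicategories. -/
def prodAdjunction {a b : B} {f : a ⟶ b} {g : b ⟶ a} (adj : f ⊣ g) {a' b' : C} {f' : a' ⟶ b'}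
    {g' : b' ⟶ a'} (adj' : f' ⊣ g') :
    Bicategory.Adjunction (B := B × C) (a := (a, a')) (b := (b, b')) (f, f') (g, g') where
  unit := (adj.unit, adj'.unit)
  counit := (adj.counit, adj'.counit)
  left_triangle := Prod.ext adj.left_triangle adj'.left_triangle
  right_triangle := Prod.ext adj.right_triangle adj'.right_triangle

theorem sectL_mapAdjunction (Y : C) {a b : B} {f : a ⟶ b} {g : b ⟶ a} (adj : f ⊣ g) :
    (Prod.sectL B Y).toPseudofunctor.mapAdjunction adj =
      prodAdjunction adj (Bicategory.Adjunction.id Y) := by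
  ext
  · exact Prod.ext ((Category.id_comp _).trans (Category.comp_id _))
      (show 𝟙 _ ≫ 𝟙 _ ≫ (λ_ (𝟙 Y)).inv = (ρ_ (𝟙 Y)).inv by simp [unitors_inv_equal])
  · exact Prod.ext ((Category.id_comp _).trans (Category.comp_id _))
      (show (λ_ (𝟙 Y)).hom ≫ 𝟙 _ ≫ 𝟙 _ = (ρ_ (𝟙 Y)).hom by simp [unitors_equal])

theorem sectR_mapAdjunction (X : B) {a b : C} {f : a ⟶ b} {g : b ⟶ a} (adj : f ⊣ g) :
    (Prod.sectR X C).toPseudofunctor.mapAdjunction adj =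
      prodAdjunction (Bicategory.Adjunction.id X) adj := by
  ext
  · exact Prod.ext ((Category.id_comp _).trans (Category.id_comp _))
      ((Category.id_comp _).trans (Category.comp_id _))
  · exact Prod.ext ((congrArg _ (Category.comp_id _)).trans (Category.comp_id _))
      ((Category.id_comp _).trans (Category.comp_id _))

end Pseudofunctors

/-! ### Crossings of wires -/

section Crossing

variable {C : Type u} [Bicategory.{w, v} C] [DaggerBicategory C] [TensorBicategory C]

/-- An adjunction in the second layer. -/
def secondLayerAdj (X : C) {Y Y' : C} {f : Y ⟶ Y'} {g : Y' ⟶ Y} (adj : f ⊣ g) :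
    secondLayer X f ⊣ secondLayer X g :=
  (leftSheet X).mapAdjunction adj

/-- The adjoint equivalence given by the right unitor at `X`. -/
def rightUnitAdj (X : C) : rightUnitorInv X ⊣ rightUnit X := rightUnitorAdj X

theorem mateEquiv_interchange_inv {X X' Y Y' : C} {f : X ⟶ X'} {g : X' ⟶ X} (adj : f ⊣ g)
    (h : Y ⟶ Y') :
    Bicategory.mateEquiv (firstLayerAdj adj Y) (firstLayerAdj adj Y') (interchange f h).inv =
      (interchange g h).hom := by
  have hadj (Z : C) : firstLayerAdj adj Z =
      tensor.mapAdjunction (prodAdjunction adj (Bicategory.Adjunction.id Z)) :=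
    (mapAdjunction_comp _ _ adj).trans (congrArg _ (sectL_mapAdjunction Z adj))
  have hmate : Bicategory.mateEquiv (prodAdjunction adj (Bicategory.Adjunction.id Y))
      (prodAdjunction adj (Bicategory.Adjunction.id Y')) (g := (𝟙 X, h)) (h := (𝟙 X', h))
      ((λ_ f).hom ≫ (ρ_ f).inv, (ρ_ h).hom ≫ (λ_ h).inv) =
        ((ρ_ g).hom ≫ (λ_ g).inv, (λ_ h).hom ≫ (ρ_ h).inv) :=
    Prod.ext (Bicategory.mateEquiv_leftUnitor_hom_rightUnitor_inv adj)
      (mateEquiv_id_rightUnitor_hom_leftUnitor_inv h)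
  have hmap := map_mateEquiv tensor (prodAdjunction adj (Bicategory.Adjunction.id Y))
    (prodAdjunction adj (Bicategory.Adjunction.id Y')) (g := (𝟙 X, h)) (h := (𝟙 X', h))
    ((λ_ f).hom ≫ (ρ_ f).inv, (ρ_ h).hom ≫ (λ_ h).inv)
  rw [hmate] at hmap
  rw [hadj, hadj]
  have hi : (interchange f h).inv = _ := Category.assoc _ _ _
  exact (congrArg _ hi).trans hmap

theorem mateEquiv_interchange_hom {X X' Y Y' : C} (k : X ⟶ X') {f : Y ⟶ Y'} {g : Y' ⟶ Y}
    (adj : f ⊣ g) :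
    Bicategory.mateEquiv (secondLayerAdj X adj) (secondLayerAdj X' adj) (interchange k f).hom =
      (interchange k g).inv := by
  have hadj (Z : C) : secondLayerAdj Z adj =
      tensor.mapAdjunction (prodAdjunction (Bicategory.Adjunction.id Z) adj) :=
    (mapAdjunction_comp _ _ adj).trans (congrArg _ (sectR_mapAdjunction Z adj))
  have hmate : Bicategory.mateEquiv (prodAdjunction (Bicategory.Adjunction.id X) adj)
      (prodAdjunction (Bicategory.Adjunction.id X') adj) (g := (k, 𝟙 Y)) (h := (k, 𝟙 Y'))
      ((ρ_ k).hom ≫ (λ_ k).inv, (λ_ f).hom ≫ (ρ_ f).inv) =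
        ((λ_ k).hom ≫ (ρ_ k).inv, (ρ_ g).hom ≫ (λ_ g).inv) :=
    Prod.ext (mateEquiv_id_rightUnitor_hom_leftUnitor_inv k)
      (Bicategory.mateEquiv_leftUnitor_hom_rightUnitor_inv adj)
  have hmap := map_mateEquiv tensor (prodAdjunction (Bicategory.Adjunction.id X) adj)
    (prodAdjunction (Bicategory.Adjunction.id X') adj) (g := (k, 𝟙 Y)) (h := (k, 𝟙 Y'))
    ((ρ_ k).hom ≫ (λ_ k).inv, (λ_ f).hom ≫ (ρ_ f).inv)
  rw [hmate] at hmap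
  rw [hadj, hadj]
  have hinv : (interchange k g).inv = _ := Category.assoc _ _ _
  exact hmap.trans hinv.symm

theorem mateEquiv_leftUnitNat_inv {X Y : C} {f : X ⟶ Y} {g : Y ⟶ X} (adj : f ⊣ g) :
    Bicategory.mateEquiv (secondLayerAdj unit adj) adj (leftUnitNat f).inv =
      (leftUnitNat g).hom := by
  have h := mateEquiv_naturality_inv (leftUnitor (C := C)) adj
  rwa [id_mapAdjunction] at h

theorem mateEquiv_rightUnitNat_inv {X Y : C} {f : X ⟶ Y} {g : Y ⟶ X} (adj : f ⊣ g) :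
    Bicategory.mateEquiv (firstLayerAdj adj unit) adj (rightUnitNat f).inv =
      (rightUnitNat g).hom := by
  have h := mateEquiv_naturality_inv (rightUnitor (C := C)) adj
  rwa [id_mapAdjunction] at h

theorem isUnitary_map₂ {X Y : C × C} {f g : X ⟶ Y} {α : f ⟶ g} (h₁ : IsUnitary α.1)
    (h₂ : IsUnitary α.2) : IsUnitary (tensor.map₂ α) := by
  rw [IsUnitary, dag_map₂, ← PrelaxFunctor.map₂_comp, ← PrelaxFunctor.map₂_comp]
  have h : α ≫ (dag α.1, dag α.2) = 𝟙 f := Prod.ext h₁.1 h₂.1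
  have h' : (dag α.1, dag α.2) ≫ α = 𝟙 g := Prod.ext h₁.2 h₂.2
  exact ⟨(congrArg tensor.map₂ h).trans (tensor.map₂_id _),
    (congrArg tensor.map₂ h').trans (tensor.map₂_id _)⟩

theorem isUnitary_interchange {X X' Y Y' : C} (f : X ⟶ X') (g : Y ⟶ Y') :
    IsUnitary (interchange f g).hom := by
  refine (mapComp_unitary _ _).inv.comp (.comp (isUnitary_map₂ ?_ ?_) (mapComp_unitary _ _))
  · exact .comp (.rightUnitor f) (IsUnitary.leftUnitor f).inv
  · exact .comp (.leftUnitor g) (IsUnitary.rightUnitor g).inv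

theorem isUnitary_leftUnitNat {X Y : C} (f : X ⟶ Y) : IsUnitary (leftUnitNat f).hom :=
  leftUnitor_naturality_unitary f

theorem isUnitary_rightUnitNat {X Y : C} (f : X ⟶ Y) : IsUnitary (rightUnitNat f).hom :=
  rightUnitor_naturality_unitary f

theorem isUnitary_unitIso : IsUnitary (unitIso (C := C)).hom := unitorIso_unitary

theorem hasUnitaryConjugate_interchange {X X' Y Y' : C} {f : X ⟶ X'} {f' : X' ⟶ X}
    (adj : f ⊣ f') {g : Y ⟶ Y'} {g' : Y' ⟶ Y} (adj' : g ⊣ g') :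
    HasUnitaryConjugate ((secondLayerAdj X adj').comp (firstLayerAdj adj Y'))
      ((firstLayerAdj adj Y).comp (secondLayerAdj X' adj')) (interchange f' g').hom := by
  rw [← mateEquiv_interchange_inv adj g', ← mateEquiv_interchange_hom f adj']
  exact .mateEquiv _ _ (isUnitary_interchange f g)

theorem hasUnitaryConjugate_leftUnitNat {X Y : C} {f : X ⟶ Y} {g : Y ⟶ X} (adj : f ⊣ g) :
    HasUnitaryConjugate ((leftUnitAdj X).comp (secondLayerAdj unit adj))
      (adj.comp (leftUnitAdj Y)) (leftUnitNat g).hom := by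
  rw [← mateEquiv_leftUnitNat_inv adj, ← (Bicategory.mateEquiv (leftUnitAdj X)
    (leftUnitAdj Y)).apply_symm_apply (leftUnitNat f).inv]
  exact .mateEquiv _ _ ((isUnitary_leftUnitNat f).inv.mateEquiv_symm
    (leftUnitorAdj_unit_unitary X) (leftUnitorAdj_counit_unitary Y))

theorem hasUnitaryConjugate_rightUnitNat {X Y : C} {f : X ⟶ Y} {g : Y ⟶ X} (adj : f ⊣ g) :
    HasUnitaryConjugate ((rightUnitAdj X).comp (firstLayerAdj adj unit))
      (adj.comp (rightUnitAdj Y)) (rightUnitNat g).hom := by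
  rw [← mateEquiv_rightUnitNat_inv adj, ← (Bicategory.mateEquiv (rightUnitAdj X)
    (rightUnitAdj Y)).apply_symm_apply (rightUnitNat f).inv]
  exact .mateEquiv _ _ ((isUnitary_rightUnitNat f).inv.mateEquiv_symm
    (rightUnitorAdj_unit_unitary X) (rightUnitorAdj_counit_unitary Y))

theorem hasUnitaryConjugate_unitIso :
    HasUnitaryConjugate (leftUnitAdj (unit : C)) (rightUnitAdj unit) unitIso.hom :=
  .of_isUnitary_unit_counit isUnitary_unitIso (leftUnitorAdj_unit_unitary unit)
    (rightUnitorAdj_counit_unitary unit)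

variable {A B : C} (a : Boundary A) (b : Boundary B)

theorem hasUnitaryConjugate_crossRight :
    HasUnitaryConjugate ((b.adj.comp (leftUnitAdj B)).comp (firstLayerAdj a.adj B))
      ((a.adj.comp (rightUnitAdj A)).comp (secondLayerAdj A b.adj)) (crossRight a b).hom := by
  have hunit := (hasUnitaryConjugate_unitIso (C := C)).whiskerLeft
    ((firstLayerAdj a.adj unit).comp (secondLayerAdj A b.adj))
  exact ((hasUnitaryConjugate_leftUnitNat b.adj).inv.whiskerLeft (firstLayerAdj a.adj B)).comp <|
    (HasUnitaryConjugate.inv (.associator _ _ _)).comp <|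
    ((hasUnitaryConjugate_interchange a.adj b.adj).whiskerRight (leftUnitAdj unit)).comp <|
    hunit.comp <|
    (HasUnitaryConjugate.associator _ _ _).comp <|
    (hasUnitaryConjugate_rightUnitNat a.adj).whiskerLeft (secondLayerAdj A b.adj)

/-- The crossing of the left boundaries of `A` and `B`, conjugate to the crossing of the right
ones. -/
def crossLeft : a.left ≫ rightUnitorInv A ≫ secondLayer A b.left ≅
    b.left ≫ leftUnitInv B ≫ firstLayer a.left B :=
  (Bicategory.conjugateIsoEquiv (b.adj.comp ((leftUnitAdj B).comp (firstLayerAdj a.adj B)))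
    (a.adj.comp ((rightUnitAdj A).comp (secondLayerAdj A b.adj)))).symm
      ((α_ _ _ _ ≪≫ crossRight a b) ≪≫ (α_ _ _ _).symm)

theorem isUnitary_crossLeft : IsUnitary (crossLeft a b).hom :=
  ((HasUnitaryConjugate.associator _ _ _).comp (hasUnitaryConjugate_crossRight a b)).comp
    (HasUnitaryConjugate.associator _ _ _).inv

theorem overlap_glue : (a.overlap b).glue =
    (secondLayer A b.right ≫ rightUnit A ≫ a.right) ◁ (crossLeft a b).inv ≫
      (α_ (secondLayer A b.right) (rightUnit A) a.right).inv ▷ _ ≫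
      (a.adj.comp ((rightUnitAdj A).comp (secondLayerAdj A b.adj))).counit :=
  adjunctionOfRightIso_counit _ _ _ _

theorem isUnitary_crossMiddle : IsUnitary (crossMiddle a b) := by
  unfold crossMiddle
  exact (IsUnitary.id _).bicategoricalComp <| .bicategoricalComp
    (.whiskerRight (leftUnitorAdj_unit_unitary B) _) <| .bicategoricalComp
    (.whiskerLeft _ (.whiskerRight (isUnitary_leftUnitNat _).inv _)) <| .bicategoricalComp
    (.whiskerLeft _ (.whiskerRight isUnitary_unitIso _)) <| .bicategoricalComp
    (.whiskerLeft _ (isUnitary_rightUnitNat _).inv) <| .bicategoricalComp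
    (.whiskerLeft _ (.whiskerRight (isUnitary_interchange _ _).inv _)) (.id _)

/-- The crossing of a right boundary of `B` over a left boundary of `A`, before the left unitor at
`B` is bent around to give `crossMiddle`. -/
def crossUnbent : leftUnit B ≫ b.right ≫ a.left ⟶
    firstLayer a.left B ≫ secondLayer A b.right ≫ rightUnit A :=
  𝟙 _ ⊗≫ (leftUnitNat b.right).inv ▷ a.left ⊗≫
    secondLayer unit b.right ◁ (unitIso.hom ▷ a.left ≫ (rightUnitNat a.left).inv) ⊗≫
    (interchange a.left b.right).inv ▷ rightUnit A ⊗≫ 𝟙 _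

theorem homEquiv₁_symm_crossUnbent :
    (leftUnitAdj B).homEquiv₁.symm (crossUnbent a b) = crossMiddle a b ≫ (α_ _ _ _).hom := by
  rw [Bicategory.Adjunction.homEquiv₁_symm_apply]
  simp only [crossUnbent, crossMiddle]
  bicategory

theorem crossRight_hom : (crossRight a b).hom =
    firstLayer a.right B ◁ (leftUnitNat b.right).inv ≫ (α_ _ _ _).inv ≫
      (interchange a.right b.right).hom ▷ leftUnit unit ≫
      (secondLayer A b.right ≫ firstLayer a.right unit) ◁ unitIso.hom ≫ (α_ _ _ _).hom ≫
      secondLayer A b.right ◁ (rightUnitNat a.right).hom :=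
  rfl

theorem mateEquiv_crossMiddle :
    Bicategory.mateEquiv ((leftUnitAdj B).comp (firstLayerAdj a.adj B)) a.adj (crossMiddle a b) =
      (α_ _ _ _ ≪≫ crossRight a b).hom ≫ (α_ _ _ _).inv := by
  have hunbent : leftUnit B ◁ crossMiddle a b ⊗≫ (leftUnitAdj B).counit ▷
      (firstLayer a.left B ≫ secondLayer A b.right ≫ rightUnit A) ⊗≫ 𝟙 _ = crossUnbent a b := by
    rw [← (leftUnitAdj B).homEquiv₁.apply_symm_apply (crossUnbent a b),
      homEquiv₁_symm_crossUnbent, Bicategory.Adjunction.homEquiv₁_apply]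
    bicategory
  have hinterchange := mateEquiv_eq_iff_counit.1 (mateEquiv_interchange_inv a.adj b.right)
  have hunitor := mateEquiv_eq_iff_counit.1 (mateEquiv_rightUnitNat_inv a.adj)
  rw [mateEquiv_eq_iff_counit]
  symm
  calc
    _ = 𝟙 _ ⊗≫ firstLayer a.right B ◁ (leftUnit B ◁ crossMiddle a b ⊗≫ (leftUnitAdj B).counit ▷
          (firstLayer a.left B ≫ secondLayer A b.right ≫ rightUnit A) ⊗≫
            𝟙 (firstLayer a.left B ≫ secondLayer A b.right ≫ rightUnit A)) ⊗≫
          (firstLayerAdj a.adj B).counit ▷ (secondLayer A b.right ≫ rightUnit A) ⊗≫ 𝟙 _ := by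
      simp only [Bicategory.Adjunction.comp, Bicategory.Adjunction.compCounit]
      bicategory
    _ = 𝟙 _ ⊗≫ firstLayer a.right B ◁ (leftUnitNat b.right).inv ▷ a.left ⊗≫
          (firstLayer a.right B ≫ secondLayer unit b.right) ◁
            (unitIso.hom ▷ a.left ≫ (rightUnitNat a.left).inv) ⊗≫
          ((α_ (firstLayer a.right B) (secondLayer unit b.right) (firstLayer a.left unit)).hom ≫
            firstLayer a.right B ◁ (interchange a.left b.right).inv ≫
            (α_ _ _ _).inv ≫ (firstLayerAdj a.adj B).counit ▷ secondLayer A b.right ≫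
              (λ_ _).hom) ▷ rightUnit A ⊗≫ 𝟙 _ := by
      rw [hunbent, crossUnbent]
      bicategory
    _ = 𝟙 _ ⊗≫ firstLayer a.right B ◁ (leftUnitNat b.right).inv ▷ a.left ⊗≫
          ((firstLayer a.right B ≫ secondLayer unit b.right) ◁
            (unitIso.hom ▷ a.left ≫ (rightUnitNat a.left).inv) ≫
          (interchange a.right b.right).hom ▷ (firstLayer a.left unit ≫ rightUnit A)) ⊗≫
          secondLayer A b.right ◁ (firstLayerAdj a.adj unit).counit ▷ rightUnit A ⊗≫ 𝟙 _ := by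
      rw [← hinterchange]
      bicategory
    _ = 𝟙 _ ⊗≫ firstLayer a.right B ◁ (leftUnitNat b.right).inv ▷ a.left ⊗≫
          (interchange a.right b.right).hom ▷ (leftUnit unit ≫ a.left) ⊗≫
          (secondLayer A b.right ≫ firstLayer a.right unit) ◁ unitIso.hom ▷ a.left ⊗≫
          secondLayer A b.right ◁ ((α_ (firstLayer a.right unit) (rightUnit unit) a.left).hom ≫
            firstLayer a.right unit ◁ (rightUnitNat a.left).inv ≫ (α_ _ _ _).inv ≫
            (firstLayerAdj a.adj unit).counit ▷ rightUnit A ≫ (λ_ _).hom) ⊗≫ 𝟙 _ := by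
      rw [whisker_exchange]
      bicategory
    _ = _ := by
      rw [← hunitor, Iso.trans_hom, crossRight_hom]
      bicategory

theorem mateEquiv_crossLeft :
    Bicategory.mateEquiv b.adj ((rightUnitAdj A).comp (secondLayerAdj A b.adj))
      (crossLeft a b).hom = crossMiddle a b := by
  rw [← (Bicategory.mateEquiv ((leftUnitAdj B).comp (firstLayerAdj a.adj B))
    a.adj).injective.eq_iff, Bicategory.iterated_mateEquiv_conjugateEquiv, mateEquiv_crossMiddle]
  exact Equiv.apply_symm_apply _ _

end Crossing

/-! ### Rotations of a vertex -/

section Rotation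

variable {C : Type u} [Bicategory.{w, v} C] [DaggerBicategory C] [TensorBicategory C]
variable {A B : C} (a : Boundary A) (b : Boundary B)

theorem partialTranspose_eq_mate (δ : a.strip ⟶ b.strip) :
    partialTranspose a b δ = (Bicategory.mateEquiv (daggerAdjunction a.adj) b.adj).symm δ := by
  rw [Bicategory.mateEquiv_symm_apply']
  simp only [partialTranspose, daggerAdjunction]
  bicategory

theorem dag_partialTranspose (δ : a.strip ⟶ b.strip) :
    dag (partialTranspose a b δ) = Bicategory.mateEquiv a.adj (daggerAdjunction b.adj) (dag δ) := by
  rw [Bicategory.mateEquiv_apply']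
  simp [partialTranspose, daggerAdjunction, bicategoricalComp, dag_comp, dag_whiskerLeft,
      dag_whiskerRight, dag_associator, dag_associator_inv, dag_leftUnitor_inv,
      dag_rightUnitor, dag_dag]

theorem halfTurnClockwise_eq_mate (δ : a.strip ⟶ b.strip) :
    halfTurnClockwise a b δ =
      (Bicategory.mateEquiv a.adj (daggerAdjunction b.adj)).symm (partialTranspose a b δ) := by
  rw [partialTranspose_eq_mate, Bicategory.iterated_mateEquiv_conjugateEquiv_symm,
    Bicategory.conjugateEquiv_symm_apply']
  simp only [halfTurnClockwise, Boundary.cup, Boundary.cap, daggerAdjunction,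
    Bicategory.Adjunction.comp, Bicategory.Adjunction.compUnit, Bicategory.Adjunction.compCounit]
  bicategory

theorem halfTurnAnticlockwise_eq_mate (δ : a.strip ⟶ b.strip) :
    halfTurnAnticlockwise a b δ =
      Bicategory.mateEquiv (daggerAdjunction b.adj) a.adj
        (Bicategory.mateEquiv b.adj (daggerAdjunction a.adj) δ) := by
  rw [Bicategory.iterated_mateEquiv_conjugateEquiv, Bicategory.conjugateEquiv_apply']
  simp only [halfTurnAnticlockwise, Boundary.cup, Boundary.cap, daggerAdjunction,
    Bicategory.Adjunction.comp, Bicategory.Adjunction.compUnit, Bicategory.Adjunction.compCounit]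
  bicategory

theorem halfTurnClockwise_eq_conjugate (δ : a.strip ⟶ b.strip) :
    halfTurnClockwise a b δ =
      (Bicategory.conjugateEquiv (a.adj.comp (daggerAdjunction a.adj))
        (b.adj.comp (daggerAdjunction b.adj))).symm δ := by
  rw [halfTurnClockwise_eq_mate, partialTranspose_eq_mate,
    Bicategory.iterated_mateEquiv_conjugateEquiv_symm]

theorem dag_halfTurnAnticlockwise (δ : a.strip ⟶ b.strip) :
    dag (halfTurnAnticlockwise a b δ) = halfTurnClockwise b a (dag δ) := by
  simp [halfTurnClockwise, halfTurnAnticlockwise, Boundary.cup, Boundary.cap,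
      bicategoricalComp, dag_comp, dag_whiskerLeft,
      dag_whiskerRight, dag_associator, dag_associator_inv, dag_leftUnitor, dag_leftUnitor_inv,
      dag_rightUnitor_inv, dag_dag]

theorem halfTurnClockwise_eq (δ : a.strip ⟶ b.strip) :
    halfTurnClockwise a b δ =
      𝟙 _ ⊗≫ a.create ▷ b.strip ⊗≫ a.left ◁ partialTranspose a b δ ▷ b.right ⊗≫
        a.strip ◁ b.destroy ⊗≫ 𝟙 _ := by
  rw [halfTurnClockwise_eq_mate, Bicategory.mateEquiv_symm_apply']
  simp only [daggerAdjunction]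
  bicategory

theorem whiskerRight_glue_eq_partialTranspose (δ : a.strip ⟶ b.strip) :
    δ ▷ b.left ⊗≫ b.left ◁ b.glue ⊗≫ 𝟙 _ =
      𝟙 _ ⊗≫ a.left ◁ partialTranspose a b δ ⊗≫ a.destroy ▷ b.left ⊗≫ 𝟙 b.left := by
  have h : a.left ◁ a.separate ⊗≫ a.destroy ▷ a.left = (ρ_ a.left).hom ≫ (λ_ a.left).inv :=
    (daggerAdjunction a.adj).right_triangle
  symm
  calc
    _ = 𝟙 _ ⊗≫ a.left ◁ a.separate ▷ (a.right ≫ b.left) ⊗≫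
          ((a.left ≫ a.right) ◁ (δ ▷ b.left ⊗≫ b.left ◁ b.glue ⊗≫ 𝟙 b.left) ≫
            a.destroy ▷ b.left) ⊗≫ 𝟙 b.left := by
      rw [partialTranspose]; bicategory
    _ = 𝟙 _ ⊗≫ (a.left ◁ a.separate ⊗≫ a.destroy ▷ a.left) ▷ (a.right ≫ b.left) ⊗≫
          (δ ▷ b.left ⊗≫ b.left ◁ b.glue ⊗≫ 𝟙 b.left) := by
      rw [whisker_exchange]; bicategory
    _ = _ := by
      rw [h]; bicategory

variable {a b}

theorem IsRotatable.isUnitary_halfTurnClockwise {δ : a.strip ⟶ b.strip} (hrot : IsRotatable a b δ)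
    (hδ : IsUnitary δ) : IsUnitary (halfTurnClockwise a b δ) := by
  have h : dag (halfTurnClockwise a b δ) = halfTurnClockwise b a (dag δ) := by
    rw [hrot, dag_halfTurnAnticlockwise]
  rw [IsUnitary, h, halfTurnClockwise_eq_conjugate, halfTurnClockwise_eq_conjugate]
  exact ⟨Bicategory.conjugateEquiv_symm_comm _ _ hδ.2, Bicategory.conjugateEquiv_symm_comm _ _ hδ.1⟩

theorem IsRotatable.isUnitary_partialTranspose_dag {δ : a.strip ⟶ b.strip}
    (hrot : IsRotatable a b δ) (hδ : IsUnitary (partialTranspose a b δ)) :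
    IsUnitary (partialTranspose b a (dag δ)) := by
  have h₁ : partialTranspose b a (dag δ) = (Bicategory.conjugateEquiv
      ((daggerAdjunction b.adj).comp a.adj) ((daggerAdjunction b.adj).comp a.adj)).symm
        (dag (partialTranspose a b δ)) := by
    rw [← Bicategory.iterated_mateEquiv_conjugateEquiv_symm, dag_partialTranspose,
      Equiv.symm_apply_apply, partialTranspose_eq_mate]
  have h₂ : dag (partialTranspose b a (dag δ)) = (Bicategory.conjugateEquiv
      ((daggerAdjunction b.adj).comp a.adj) ((daggerAdjunction b.adj).comp a.adj)).symm
        (partialTranspose a b δ) := by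
    rw [← Bicategory.iterated_mateEquiv_conjugateEquiv_symm, dag_partialTranspose, dag_dag,
      ← halfTurnClockwise_eq_mate, hrot, halfTurnAnticlockwise_eq_mate, Equiv.symm_apply_apply]
  rw [IsUnitary, h₂, h₁]
  exact ⟨Bicategory.conjugateEquiv_symm_comm _ _ hδ.1, Bicategory.conjugateEquiv_symm_comm _ _ hδ.2⟩

end Rotation

/-! ### The communication structure -/

section Communication

variable {C : Type u} [Bicategory.{w, v} C] [DaggerBicategory C] [TensorBicategory C]
variable {A B : C} (a : Boundary A) (b : Boundary B)

theorem cup_whiskerLeft_destroy {D : C} {P Q R : (unit : C) ⟶ D} (X : P ⟶ Q)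
    (Y : a.right ≫ Q ⟶ a.right ≫ R) :
    𝟙 _ ⊗≫ a.cup ▷ P ⊗≫ a.strip ◁ (a.strip ◁ X ⊗≫ a.left ◁ Y ⊗≫ a.destroy ▷ R ⊗≫ 𝟙 R) ⊗≫
        𝟙 (a.strip ≫ R) =
      X ⊗≫ a.create ▷ Q ⊗≫ a.left ◁ Y ⊗≫ 𝟙 (a.strip ≫ R) := by
  have h : a.separate ▷ a.right ⊗≫ a.right ◁ a.destroy = (λ_ a.right).hom ≫ (ρ_ a.right).inv :=
    (daggerAdjunction a.adj).left_triangle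
  calc
    _ = 𝟙 _ ⊗≫ (a.cup ▷ P ≫ (a.strip ≫ a.strip) ◁ X) ⊗≫
          a.strip ◁ (a.left ◁ Y ⊗≫ a.destroy ▷ R ⊗≫ 𝟙 R) ⊗≫ 𝟙 (a.strip ≫ R) := by
      bicategory
    _ = X ⊗≫ a.create ▷ Q ⊗≫
          a.left ◁ (a.separate ▷ (a.right ≫ Q) ≫ (a.right ≫ a.left) ◁ Y) ⊗≫
          a.strip ◁ a.destroy ▷ R ⊗≫ 𝟙 (a.strip ≫ R) := by
      rw [← whisker_exchange, Boundary.cup]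
      bicategory
    _ = X ⊗≫ a.create ▷ Q ⊗≫ a.left ◁ Y ⊗≫
          a.left ◁ (a.separate ▷ a.right ⊗≫ a.right ◁ a.destroy) ▷ R ⊗≫ 𝟙 (a.strip ≫ R) := by
      rw [← whisker_exchange]
      bicategory
    _ = _ := by
      rw [h]
      bicategory

theorem whiskerRight_counit_eq_whiskerLeft_destroy {D V : C} {F : B ⟶ D} {s : D ⟶ V}
    {t : V ⟶ A} {E : A ⟶ D} (δ : a.strip ⟶ b.strip) (ω : a.right ≫ b.left ⟶ a.right ≫ b.left)
    (χ : b.right ≫ a.left ⟶ F ≫ s ≫ t)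
    (gD : (s ≫ t ≫ a.right) ≫ b.left ≫ F ⟶ 𝟙 D) (e : a.left ≫ E ≅ b.left ≫ F)
    (h : χ ▷ (a.right ≫ b.left ≫ F) ⊗≫ F ◁ gD ⊗≫ 𝟙 F =
      𝟙 _ ⊗≫ (b.right ≫ a.left ≫ a.right) ◁ e.inv ⊗≫ (b.right ≫ a.left) ◁ a.glue ▷ E ⊗≫
        b.right ◁ e.hom ⊗≫ b.glue ▷ F ⊗≫ 𝟙 _) :
    (𝟙 (a.strip ≫ b.strip) ⊗≫ a.left ◁ ω ▷ b.right ⊗≫ δ ▷ b.strip ≫ b.strip ◁ dag δ ⊗≫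
        b.left ◁ χ ▷ a.right ⊗≫ 𝟙 ((b.left ≫ F) ≫ (s ≫ t ≫ a.right))) ▷ (b.left ≫ F) ⊗≫
      (b.left ≫ F) ◁ gD ⊗≫ 𝟙 (b.left ≫ F) =
    𝟙 _ ⊗≫ a.strip ◁ (𝟙 (b.strip ≫ b.left ≫ F) ⊗≫ b.strip ◁ e.inv ⊗≫
        b.left ◁ partialTranspose b a (dag δ) ▷ E ⊗≫ 𝟙 (b.strip ≫ a.left ≫ E)) ⊗≫
      a.left ◁ (𝟙 (a.right ≫ b.strip ≫ a.left ≫ E) ⊗≫ ω ▷ (b.right ≫ a.left ≫ E) ⊗≫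
        a.right ◁ b.destroy ▷ (a.left ≫ E) ⊗≫ a.right ◁ e.hom ⊗≫ partialTranspose a b δ ▷ F ⊗≫
        𝟙 (a.right ≫ b.left ≫ F)) ⊗≫
      a.destroy ▷ (b.left ≫ F) ⊗≫ 𝟙 (b.left ≫ F) := by
  calc
    _ = 𝟙 _ ⊗≫ a.left ◁ ω ▷ (b.right ≫ b.left ≫ F) ⊗≫
          (δ ▷ b.strip ≫ b.strip ◁ dag δ) ▷ (b.left ≫ F) ⊗≫
          b.left ◁ (χ ▷ (a.right ≫ b.left ≫ F) ⊗≫ F ◁ gD ⊗≫ 𝟙 F) ⊗≫ 𝟙 (b.left ≫ F) := by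
      bicategory
    _ = 𝟙 _ ⊗≫ a.left ◁ ω ▷ (b.right ≫ b.left ≫ F) ⊗≫ δ ▷ (b.strip ≫ b.left ≫ F) ⊗≫
          b.strip ◁ (dag δ ▷ (b.left ≫ F) ≫ a.strip ◁ e.inv) ⊗≫
          (b.strip ≫ a.left) ◁ a.glue ▷ E ⊗≫ b.strip ◁ e.hom ⊗≫ b.left ◁ b.glue ▷ F ⊗≫
          𝟙 (b.left ≫ F) := by
      rw [h]
      bicategory
    _ = 𝟙 _ ⊗≫ a.left ◁ ω ▷ (b.right ≫ b.left ≫ F) ⊗≫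
          (δ ▷ (b.strip ≫ b.left ≫ F) ≫ b.strip ◁ (b.strip ◁ e.inv ⊗≫
            (dag δ ▷ a.left ⊗≫ a.left ◁ a.glue ⊗≫ 𝟙 a.left) ▷ E ⊗≫ e.hom)) ⊗≫
          b.left ◁ b.glue ▷ F ⊗≫ 𝟙 (b.left ≫ F) := by
      rw [← whisker_exchange]
      bicategory
    _ = 𝟙 _ ⊗≫ (a.left ◁ ω ▷ (b.right ≫ b.left ≫ F) ⊗≫ 𝟙 (a.strip ≫ b.strip ≫ b.left ≫ F)) ⊗≫
          a.strip ◁ (b.strip ◁ e.inv ⊗≫ b.left ◁ partialTranspose b a (dag δ) ▷ E ⊗≫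
            b.destroy ▷ (a.left ≫ E) ⊗≫ e.hom) ⊗≫
          (δ ▷ b.left ⊗≫ b.left ◁ b.glue ⊗≫ 𝟙 b.left) ▷ F := by
      rw [← whisker_exchange, whiskerRight_glue_eq_partialTranspose]
      bicategory
    _ = 𝟙 _ ⊗≫ a.left ◁ (ω ▷ (b.right ≫ b.left ≫ F) ≫ (a.right ≫ b.left) ◁
            (b.right ◁ e.inv ⊗≫ partialTranspose b a (dag δ) ▷ E ⊗≫ 𝟙 (b.right ≫ a.left ≫ E))) ⊗≫
          a.strip ◁ (b.destroy ▷ (a.left ≫ E) ⊗≫ e.hom) ⊗≫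
          (𝟙 (a.strip ≫ b.left) ⊗≫ a.left ◁ partialTranspose a b δ ⊗≫
            a.destroy ▷ b.left ⊗≫ 𝟙 b.left) ▷ F := by
      rw [whiskerRight_glue_eq_partialTranspose]
      bicategory
    _ = _ := by
      rw [← whisker_exchange]
      bicategory

theorem commPartialTranspose_eq {D V : C} {F : B ⟶ D} {s : D ⟶ V} {t : V ⟶ A} {E : A ⟶ D}
    (adjE : E ⊣ s ≫ t) (e : a.left ≫ E ≅ b.left ≫ F) (adjD : b.left ≫ F ⊣ s ≫ t ≫ a.right)
    (hD : adjD.counit = (s ≫ t ≫ a.right) ◁ e.inv ≫ (α_ s t a.right).inv ▷ (a.left ≫ E) ≫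
      (a.adj.comp adjE).counit)
    (δ : a.strip ⟶ b.strip) {l : a.strip ≫ b.strip ⟶ (b.left ≫ F) ≫ s ≫ t ≫ a.right}
    (hl : l = 𝟙 (a.strip ≫ b.strip) ⊗≫ a.left ◁ partialTranspose a b δ ▷ b.right ⊗≫
        δ ▷ b.strip ≫ b.strip ◁ dag δ ⊗≫
        b.left ◁ Bicategory.mateEquiv b.adj adjE e.hom ▷ a.right ⊗≫
        𝟙 ((b.left ≫ F) ≫ (s ≫ t ≫ a.right))) :
    commPartialTranspose a b ⟨b.left ≫ F, s ≫ t ≫ a.right, adjD⟩ l =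
    𝟙 (b.strip ≫ b.left ≫ F) ⊗≫ b.strip ◁ e.inv ⊗≫
      b.left ◁ partialTranspose b a (dag δ) ▷ E ⊗≫
      halfTurnClockwise a b δ ▷ (a.left ≫ E) ⊗≫ a.strip ◁ e.hom ⊗≫
      a.left ◁ partialTranspose a b δ ▷ F ⊗≫ 𝟙 (a.strip ≫ b.left ≫ F) := by
  have hcounit := mateEquiv_whiskerRight_counit a.adj b.adj adjE e
  rw [← hD] at hcounit
  refine Eq.trans ?_ ((cup_whiskerLeft_destroy a
    (𝟙 (b.strip ≫ b.left ≫ F) ⊗≫ b.strip ◁ e.inv ⊗≫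
      b.left ◁ partialTranspose b a (dag δ) ▷ E ⊗≫ 𝟙 (b.strip ≫ a.left ≫ E))
    (𝟙 (a.right ≫ b.strip ≫ a.left ≫ E) ⊗≫ partialTranspose a b δ ▷ (b.right ≫ a.left ≫ E) ⊗≫
      a.right ◁ b.destroy ▷ (a.left ≫ E) ⊗≫ a.right ◁ e.hom ⊗≫
      partialTranspose a b δ ▷ F ⊗≫ 𝟙 (a.right ≫ b.left ≫ F))).trans ?_)
  · calc
      _ = 𝟙 (b.strip ≫ b.left ≫ F) ⊗≫ a.cup ▷ (b.strip ≫ b.left ≫ F) ⊗≫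
            a.strip ◁ (l ▷ (b.left ≫ F) ⊗≫ (b.left ≫ F) ◁ adjD.counit ⊗≫ 𝟙 (b.left ≫ F)) ⊗≫
            𝟙 (a.strip ≫ b.left ≫ F) := by
        dsimp only [commPartialTranspose, Boundary.glue]
        bicategory
      _ = _ := by
        rw [hl, whiskerRight_counit_eq_whiskerLeft_destroy a b δ _ _ _ e hcounit]
        bicategory
  · rw [halfTurnClockwise_eq]
    bicategory

/-- The composite of rotated copies of `δ` and of crossings of the left boundaries that is
obtained by bending the strip of `A` and the right boundary of `A ⊠ B` in `commOfComp a b δ`. -/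
def rotatedComp (δ : a.strip ⟶ b.strip) : b.strip ≫ b.left ≫ leftUnitInv B ≫ firstLayer a.left B ⟶
    a.strip ≫ b.left ≫ leftUnitInv B ≫ firstLayer a.left B :=
  𝟙 _ ⊗≫ b.strip ◁ (crossLeft a b).inv ⊗≫
    b.left ◁ partialTranspose b a (dag δ) ▷ (rightUnitorInv A ≫ secondLayer A b.left) ⊗≫
    halfTurnClockwise a b δ ▷ (a.left ≫ rightUnitorInv A ≫ secondLayer A b.left) ⊗≫
    a.strip ◁ (crossLeft a b).hom ⊗≫
    a.left ◁ partialTranspose a b δ ▷ (leftUnitInv B ≫ firstLayer a.left B) ⊗≫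
    𝟙 (a.strip ≫ b.left ≫ leftUnitInv B ≫ firstLayer a.left B)

theorem commPartialTranspose_overlap (δ : a.strip ⟶ b.strip) :
    commPartialTranspose a b (a.overlap b) (commOfComp a b δ) = rotatedComp a b δ :=
  commPartialTranspose_eq a b ((rightUnitAdj A).comp (secondLayerAdj A b.adj)) (crossLeft a b)
    (a.overlap b).adj (overlap_glue a b) δ (by
      rw [mateEquiv_crossLeft, commOfComp]
      bicategory)

variable {a b}

theorem isUnitary_rotatedComp {δ : a.strip ⟶ b.strip} (hδ : IsComplementaryStructure a b δ)
    (hrot : IsRotatable a b δ) : IsUnitary (rotatedComp a b δ) := by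
  unfold rotatedComp
  exact (IsUnitary.id _).bicategoricalComp <| .bicategoricalComp
    (.whiskerLeft _ (isUnitary_crossLeft a b).inv) <| .bicategoricalComp
    (.whiskerLeft _ (.whiskerRight (hrot.isUnitary_partialTranspose_dag hδ.2) _)) <|
    .bicategoricalComp (.whiskerRight (hrot.isUnitary_halfTurnClockwise hδ.1) _) <|
    .bicategoricalComp (.whiskerLeft _ (isUnitary_crossLeft a b)) <|
    .bicategoricalComp (.whiskerLeft _ (.whiskerRight hδ.2 _)) (.id _)

theorem isUnitary_commOfComp {δ : a.strip ⟶ b.strip} (h : IsComplementaryStructure a b δ) :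
    IsUnitary (commOfComp a b δ) := by
  unfold commOfComp
  exact (IsUnitary.id _).bicategoricalComp <| .bicategoricalComp
    (.whiskerLeft _ (.whiskerRight h.2 _)) <| .comp (.whiskerRight h.1 _) <|
    .bicategoricalComp (.whiskerLeft _ h.1.dag) <| .bicategoricalComp
    (.whiskerLeft _ (.whiskerRight (isUnitary_crossMiddle a b) _)) (.id _)

end Communication

/-- Let `C` be a dagger bicategory with a tensor product, and let `A` and `B` be regions of `C` with
boundaries satisfying the topological axioms. If `δ` is a complementary structure, then the
2-morphism built from three copies of `δ` is a communication structure. -/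
theorem mainTheorem1 {C : Type u} [Bicategory.{w, v} C] [DaggerBicategory C] [TensorBicategory C]
    {A B : C} (a : Boundary A) (b : Boundary B) (δ : a.strip ⟶ b.strip)
    (hδ : IsComplementaryStructure a b δ) (hrot : IsRotatable a b δ) :
    IsCommunicationStructure a b (a.overlap b) (commOfComp a b δ) := by
  refine ⟨isUnitary_commOfComp hδ, ?_⟩
  rw [commPartialTranspose_overlap]
  exact isUnitary_rotatedComp hδ hrot
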